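/- For a simple graph $G$ on $n$ vertices, a complex Hermitian matrix $A$ with rows and columns indexed by the vertices of $G$ is said to have graph $G$ if, for all distinct vertices $i,j$, $A_{ij}\neq 0$ exactly when $i$ and $j$ are adjacent in $G$ (the diagonal of $A$ is unrestricted). Let $\operatorname{mr}(G)$ be the minimum rank of a complex Hermitian matrix with graph $G$, and let $\operatorname{msr}(G)$ be the minimum rank of a positive semidefinite Hermitian matrix with graph $G$. If the vertex set of $G$ is $\mathbb{Z}/n\mathbb{Z}=\{0,1,\ldots,n-1\}$, let $\operatorname{mscr}(G)$ be the minimum rank of a positive semidefinite Hermitian circulant matrix with graph $G$, where $A$ is circulant if $A_{ij}$ depends only on $i-j$ modulo $n$. For $S\subseteq \mathbb{Z}/n\mathbb{Z}\setminus\{0\}$ with $S=-S$, let $\operatorname{Circ}(n,S)$ be the graph on $\mathbb{Z}/n\mathbb{Z}$ in which $i$ and $j$ are adjacent if and only if $i-j\in S$. **Theorem.** Let $n$ and $k$ be integers with $1\le k\le\lfloor n/2\rfloor$, let $S=\{\pm1,\pm2,\ldots,\pm k\}\subseteq\mathbb{Z}/n\mathbb{Z}$, and let $G=\operatorname{Circ}(n,S)$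 (a consecutive circulant graph). Then $$\operatorname{mscr}(G)=\operatorname{msr}(G)=\operatorname{mr}(G)=n-|S|.$$ -/

import Mathlib

open scoped ComplexOrder

namespace CirculantRank

/-- `G` is the graph of the matrix `A`: off the diagonal, the nonzero entries of `A` are exactly
those indexed by the edges of `G`. The diagonal of `A` is unconstrained. -/
def IsGraphOf {V : Type*} (G : SimpleGraph V) (A : Matrix V V ℂ) : Prop :=
  ∀ i j : V, i ≠ j → (G.Adj i j ↔ A i j ≠ 0)

/-- The set of all complex Hermitian matrices with graph `G`. -/
def hermitianClass {V : Type*} (G : SimpleGraph V) : Set (Matrix V V ℂ) :=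
  {A | A.IsHermitian ∧ IsGraphOf G A}

/-- The set of all positive semidefinite Hermitian matrices with graph `G`
(`Matrix.PosSemidef` includes being Hermitian). -/
def posSemidefClass {V : Type*} (G : SimpleGraph V) : Set (Matrix V V ℂ) :=
  {A | A.PosSemidef ∧ IsGraphOf G A}

/-- A square matrix indexed by the residues modulo `n` is circulant if its `(i, j)` entry depends
only on `i - j` modulo `n`. -/
def IsCirculantMatrix {n : ℕ} (A : Matrix (ZMod n) (ZMod n) ℂ) : Prop :=
  ∃ b : ZMod n → ℂ, A = Matrix.circulant b

/-- The minimum rank of `G`. The `sInf` of a nonempty set of naturals is its minimum (over the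
empty set it is `0`; hence a positive value of `mr`, `msr` or `mscr` is always attained). -/
noncomputable def mr {V : Type*} [Fintype V] (G : SimpleGraph V) : ℕ :=
  sInf {r | ∃ A ∈ hermitianClass G, A.rank = r}

/-- The minimum semidefinite rank of `G`. -/
noncomputable def msr {V : Type*} [Fintype V] (G : SimpleGraph V) : ℕ :=
  sInf {r | ∃ A ∈ posSemidefClass G, A.rank = r}

/-- The minimum semidefinite circulant rank of a graph `G` on the residues modulo `n`. -/
noncomputable def mscr {n : ℕ} [NeZero n] (G : SimpleGraph (ZMod n)) : ℕ :=
  sInf {r | ∃ A ∈ posSemidefClass G, IsCirculantMatrix A ∧ A.rank = r}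

/-- The set `{±1, ±2, …, ±k}` of residues modulo `n`. -/
def consecutiveSet (n k : ℕ) : Finset (ZMod n) :=
  (Finset.Icc 1 k).image (fun j : ℕ => (j : ZMod n)) ∪
    (Finset.Icc 1 k).image (fun j : ℕ => -(j : ZMod n))

/-- The circulant graph `Circ(n, S)` on the residues modulo `n`. When `S` is closed under negation
and does not contain `0`, vertices `i` and `j` are adjacent iff `i - j ∈ S`. -/
def circ (n : ℕ) (S : Finset (ZMod n)) : SimpleGraph (ZMod n) :=
  SimpleGraph.circulantGraph (S : Set (ZMod n))

end CirculantRank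

namespace CirculantRank

open Polynomial Finset

/-! For `2k < n`, every matrix with this graph has a triangular submatrix of order `n - 2k` with
nonzero diagonal (`sub_two_mul_le_rank`), which bounds all three ranks below. One circulant matrix
attains the bound. Its eigenvalues are `λ_j = ∏_{t=1}^{2k} 2 sin(π(j+t)/n)` for `0 ≤ j < n`:
nonnegative, and zero on the last `2k` indices. With `ω = exp(2πi/n)`, `λ_j = c ω^{-kj} P(ω^j)`
where `P = ∏_{t=1}^{2k} (ω^t X - 1)` (`sineProd_eq_eval`), so the matrix entries are multiples of
the `2k + 1` coefficients of `P`, placed at the differences `-k, …, k`. These are Gaussian binomials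
up to units, nonzero because `2k < n` (`coeff_qProd_ne_zero`). If `n = 2k` the graph is complete and
the all-ones matrix has rank 1. -/

theorem natCast_mem_consecutiveSet {n k d : ℕ} (hk : k < n) (hd : 0 < d) (hdn : d < n) :
    (d : ZMod n) ∈ consecutiveSet n k ↔ d ≤ k ∨ n - k ≤ d := by
  have : NeZero n := ⟨by omega⟩
  simp only [consecutiveSet, mem_union, mem_image, mem_Icc]
  constructor
  · rintro (⟨j, ⟨h1, h2⟩, h⟩ | ⟨j, ⟨h1, h2⟩, h⟩)
    · rw [ZMod.natCast_eq_natCast_iff', Nat.mod_eq_of_lt (by omega),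
        Nat.mod_eq_of_lt hdn] at h
      omega
    · have h' : ((d + j : ℕ) : ZMod n) = 0 := by push_cast; rw [← h]; ring
      rw [ZMod.natCast_eq_zero_iff] at h'
      have := Nat.le_of_dvd (by omega) h'
      omega
  · rintro (h | h)
    · exact Or.inl ⟨d, ⟨hd, h⟩, rfl⟩
    · refine Or.inr ⟨n - d, ⟨by omega, by omega⟩, ?_⟩
      rw [Nat.cast_sub hdn.le]
      simp

theorem zero_notMem_consecutiveSet {n k : ℕ} (hk : k < n) : 0 ∉ consecutiveSet n k := by
  simp only [consecutiveSet, mem_union, mem_image, mem_Icc, neg_eq_zero,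
    ZMod.natCast_eq_zero_iff]
  rintro (⟨j, ⟨h1, h2⟩, h⟩ | ⟨j, ⟨h1, h2⟩, h⟩) <;>
  · have := Nat.le_of_dvd (by omega) h
    omega

theorem neg_mem_consecutiveSet {n k : ℕ} {x : ZMod n} (hx : x ∈ consecutiveSet n k) :
    -x ∈ consecutiveSet n k := by
  simp only [consecutiveSet, mem_union, mem_image] at hx ⊢
  rcases hx with ⟨j, h1, rfl⟩ | ⟨j, h1, rfl⟩
  · exact Or.inr ⟨j, h1, rfl⟩
  · exact Or.inl ⟨j, h1, by simp⟩

theorem consecutiveSet_eq_image {n k : ℕ} (hk : k < n) :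
    consecutiveSet n k =
      (Icc 1 k ∪ Icc (n - k) (n - 1)).image (fun d : ℕ => (d : ZMod n)) := by
  have : NeZero n := ⟨by omega⟩
  ext x
  constructor
  · intro hx
    have hv := x.val_lt
    have h0 : 0 < x.val := by
      rw [Nat.pos_iff_ne_zero]
      intro h
      rw [ZMod.val_eq_zero] at h
      exact zero_notMem_consecutiveSet hk (h ▸ hx)
    rw [← ZMod.natCast_zmod_val x, natCast_mem_consecutiveSet hk h0 hv] at hx
    refine mem_image.2 ⟨x.val, ?_, ZMod.natCast_zmod_val x⟩
    simp only [mem_union, mem_Icc]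
    omega
  · intro hx
    obtain ⟨d, hd, rfl⟩ := mem_image.1 hx
    simp only [mem_union, mem_Icc] at hd
    exact (natCast_mem_consecutiveSet hk (by omega) (by omega)).2 (by omega)

theorem card_consecutiveSet_eq_card_union {n k : ℕ} (hk : k < n) :
    (consecutiveSet n k).card = (Icc 1 k ∪ Icc (n - k) (n - 1)).card := by
  rw [consecutiveSet_eq_image hk, card_image_of_injOn]
  intro a ha b hb h
  simp only [coe_union, coe_Icc, Set.mem_union, Set.mem_Icc] at ha hb
  simp only [ZMod.natCast_eq_natCast_iff'] at h
  rwa [Nat.mod_eq_of_lt (by omega), Nat.mod_eq_of_lt (by omega)] at h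

theorem card_consecutiveSet {n k : ℕ} (hk : 2 * k < n) :
    (consecutiveSet n k).card = 2 * k := by
  rw [card_consecutiveSet_eq_card_union (by omega), card_union_of_disjoint]
  · simp only [Nat.card_Icc]; omega
  · rw [disjoint_left]
    intro a ha hb
    simp only [mem_Icc] at ha hb
    omega

theorem card_consecutiveSet_half {n k : ℕ} (hk : 1 ≤ k) (h : n = 2 * k) :
    (consecutiveSet n k).card = n - 1 := by
  rw [card_consecutiveSet_eq_card_union (by omega)]
  have : Icc 1 k ∪ Icc (n - k) (n - 1) = Icc 1 (n - 1) := by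
    ext a
    simp only [mem_union, mem_Icc]
    omega
  rw [this, Nat.card_Icc]
  omega

theorem circ_consecutiveSet_adj {n k : ℕ} (hk : k < n) (x y : ZMod n) :
    (circ n (consecutiveSet n k)).Adj x y ↔ x - y ∈ consecutiveSet n k := by
  simp only [circ, SimpleGraph.circulantGraph_adj, mem_coe]
  constructor
  · rintro ⟨-, h | h⟩
    · exact h
    · simpa using neg_mem_consecutiveSet h
  · intro h
    refine ⟨fun hxy => zero_notMem_consecutiveSet hk ?_, Or.inl h⟩
    rwa [hxy, sub_self] at h

/-! ### Lower bound: a triangular submatrix -/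

/-- The maximal triangular submatrix with rows `0, …, n - 2k - 1` and columns
`k, …, n - k - 1` has nonzero diagonal. -/
theorem sub_two_mul_le_rank {n k : ℕ} [NeZero n] (hk : 1 ≤ k) (hkn : 2 * k < n)
    {A : Matrix (ZMod n) (ZMod n) ℂ} (hA : IsGraphOf (circ n (consecutiveSet n k)) A) :
    n - 2 * k ≤ A.rank := by
  set f : Fin (n - 2 * k) → ZMod n := fun i => ((i : ℕ) : ZMod n)
  set g : Fin (n - 2 * k) → ZMod n := fun i => ((i + k : ℕ) : ZMod n)
  have hne : ∀ i j, i ≤ j → f i ≠ g j := by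
    intro i j hij h
    have hij' : (i : ℕ) ≤ j := hij
    simp only [f, g, ZMod.natCast_eq_natCast_iff'] at h
    rw [Nat.mod_eq_of_lt (by omega), Nat.mod_eq_of_lt (by omega)] at h
    omega
  -- The difference `j + k - i` lies between `k` and `n - k - 1`, so it meets the connection set
  -- only at `k`.
  have hent : ∀ i j, i ≤ j → (A (f i) (g j) ≠ 0 ↔ i = j) := by
    intro i j hij
    have hij' : (i : ℕ) ≤ j := hij
    rw [← hA _ _ (hne i j hij), SimpleGraph.adj_comm, circ_consecutiveSet_adj (by omega)]
    have : g j - f i = ((j + k - i : ℕ) : ZMod n) := by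
      rw [Nat.cast_sub (by omega)]
    rw [this, natCast_mem_consecutiveSet (by omega) (by omega) (by omega), Fin.ext_iff]
    omega
  have hdet : (A.submatrix f g).det ≠ 0 := by
    rw [Matrix.det_of_isLowerTriangular, prod_ne_zero_iff]
    · exact fun i _ => (hent i i le_rfl).2 rfl
    · intro i j hij
      have hij' : i < j := hij
      by_contra h
      exact hij'.ne ((hent i j hij'.le).1 h)
  have hr := Matrix.rank_of_isUnit (A.submatrix f g)
    ((Matrix.isUnit_iff_isUnit_det _).2 (isUnit_iff_ne_zero.2 hdet))
  rw [Fintype.card_fin] at hr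
  rw [← hr]
  exact Matrix.rank_submatrix_le _ _ _

/-! ### Nonvanishing of the Gaussian binomials -/

/-- The coefficients of `∏ (q ^ (t + 1) X - 1)` over `t < N`, which are up to units the `q`-binomial
coefficients, satisfy a two-term recurrence. -/
theorem coeff_qProd_recurrence (q : ℂ) (N m : ℕ) :
    (∏ t ∈ range N, (C (q ^ (t + 1)) * X - 1 : ℂ[X])).coeff (m + 1) * (1 - q ^ (m + 1)) =
      (∏ t ∈ range N, (C (q ^ (t + 1)) * X - 1 : ℂ[X])).coeff m *
        (q ^ (N + 1) - q ^ (m + 1)) := by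
  set P : ℂ[X] := ∏ t ∈ range N, (C (q ^ (t + 1)) * X - 1 : ℂ[X]) with hP
  -- Both sides are the product with `N + 1` factors; comparing coefficients of `X ^ (m + 1)` gives
  -- the recurrence.
  have h : P.comp (C q * X) * (C q * X - 1) = P * (C (q ^ (N + 1)) * X - 1) := by
    rw [hP, ← prod_range_succ (fun t => (C (q ^ (t + 1)) * X - 1 : ℂ[X])),
      prod_range_succ', Polynomial.prod_comp]
    congr 1
    · refine prod_congr rfl fun t _ => ?_
      simp only [sub_comp, mul_comp, C_comp, X_comp, one_comp, ← mul_assoc, ← C_mul, ← pow_succ]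
    · simp
  have h' := congrArg (fun p => p.coeff (m + 1)) h
  simp only [mul_sub, mul_one, coeff_sub, ← mul_assoc, coeff_mul_X, coeff_mul_C,
    comp_C_mul_X_coeff] at h'
  linear_combination h'

/-- By the recurrence, a first vanishing coefficient at `m + 1` would force `q ^ (N - m) = 1` with
`0 < N - m < n`. -/
theorem coeff_qProd_ne_zero {q : ℂ} {n N : ℕ} (hq : IsPrimitiveRoot q n) (hN : N < n)
    {m : ℕ} (hm : m ≤ N) :
    (∏ t ∈ range N, (C (q ^ (t + 1)) * X - 1 : ℂ[X])).coeff m ≠ 0 := by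
  induction m with
  | zero => simp [coeff_zero_eq_eval_zero, eval_prod]
  | succ m ih =>
    intro h0
    have h := coeff_qProd_recurrence q N m
    rw [h0, zero_mul, eq_comm, mul_eq_zero] at h
    rcases h with h | h
    · exact ih (by omega) h
    · have h := sub_eq_zero.1 h
      have hpow : q ^ (N - m) = 1 := by
        have hq0 : q ≠ 0 := hq.ne_zero (by omega)
        have : q ^ (N + 1) = q ^ (N - m) * q ^ (m + 1) := by
          rw [← pow_add]; congr 1; omega
        rw [this] at h
        exact mul_right_cancel₀ (pow_ne_zero _ hq0) (h.trans (one_mul _).symm)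
      exact hq.pow_ne_one_of_pos_of_lt (by omega) (by omega) hpow

theorem natDegree_qProd_le (q : ℂ) (N : ℕ) :
    (∏ t ∈ range N, (C (q ^ (t + 1)) * X - 1 : ℂ[X])).natDegree ≤ N := by
  refine (natDegree_prod_le _ _).trans ((sum_le_card_nsmul _ _ 1 fun t _ => ?_).trans (by simp))
  compute_degree

/-! ### The extremal circulant matrix -/

/-- The eigenvalues of the extremal circulant matrix. -/
noncomputable def sineProd (n k : ℕ) (j : ZMod n) : ℝ :=
  ∏ t ∈ range (2 * k), (2 * Real.sin (Real.pi * (j.val + t + 1) / n))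

theorem sineProd_eq_zero {n k : ℕ} [NeZero n] {j : ZMod n} (hj : n - 2 * k ≤ j.val) :
    sineProd n k j = 0 := by
  have hv := j.val_lt
  -- This factor has angle exactly `π`.
  refine prod_eq_zero (i := n - 1 - j.val) (mem_range.2 (by omega)) ?_
  have hn : (n : ℝ) ≠ 0 := Nat.cast_ne_zero.2 (NeZero.ne n)
  have : (j.val : ℝ) + (n - 1 - j.val : ℕ) + 1 = n := by
    norm_cast; omega
  rw [this, mul_div_cancel_right₀ _ hn, Real.sin_pi, mul_zero]

theorem sineProd_nonneg {n k : ℕ} [NeZero n] (j : ZMod n) : 0 ≤ sineProd n k j := by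
  rcases le_or_gt (n - 2 * k) j.val with h | h
  · exact (sineProd_eq_zero h).ge
  · have hn : (0 : ℝ) < n := Nat.cast_pos.2 (Nat.pos_of_neZero n)
    refine prod_nonneg fun t ht => mul_nonneg zero_le_two ?_
    refine Real.sin_nonneg_of_nonneg_of_le_pi (by positivity) ?_
    rw [div_le_iff₀ hn]
    refine mul_le_mul_of_nonneg_left ?_ Real.pi_pos.le
    have := mem_range.1 ht
    norm_cast
    omega

theorem stdAddChar_eq_exp {n : ℕ} [NeZero n] (j : ZMod n) :
    ZMod.stdAddChar j = Complex.exp (2 * Real.pi * Complex.I * j.val / n) := by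
  conv_lhs => rw [← ZMod.natCast_zmod_val j]
  exact_mod_cast ZMod.stdAddChar_coe (N := n) (j.val : ℤ)

theorem isPrimitiveRoot_stdAddChar_one (n : ℕ) [NeZero n] :
    IsPrimitiveRoot (ZMod.stdAddChar (1 : ZMod n)) n := by
  have h := ZMod.stdAddChar_coe (N := n) 1
  rw [Int.cast_one, Int.cast_one, mul_one] at h
  rw [h]
  exact Complex.isPrimitiveRoot_exp n (NeZero.ne n)

/-- Apply `2 sin θ = -i e^{-iθ} (e^{2iθ} - 1)` to each factor. The number of factors is even, so the
half-angle phases `e^{-πij/n}` multiply to a genuine character of `j`. -/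
theorem sineProd_eq_eval (n k : ℕ) [NeZero n] :
    ∃ c : ℂ, c ≠ 0 ∧ ∀ j : ZMod n, (sineProd n k j : ℂ) =
      c * ZMod.stdAddChar (-((k : ZMod n) * j)) *
        (∏ t ∈ range (2 * k),
          (C (ZMod.stdAddChar (1 : ZMod n) ^ (t + 1)) * X - 1 : ℂ[X])).eval
            (ZMod.stdAddChar j) := by
  have hn : (n : ℂ) ≠ 0 := Nat.cast_ne_zero.2 (NeZero.ne n)
  have h1 : ZMod.stdAddChar (1 : ZMod n) = Complex.exp (2 * Real.pi * Complex.I / n) := by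
    have h := ZMod.stdAddChar_coe (N := n) 1
    rwa [Int.cast_one, Int.cast_one, mul_one] at h
  refine ⟨∏ t ∈ range (2 * k), (-Complex.I * Complex.exp (-(Real.pi * Complex.I * (t + 1) / n))),
    prod_ne_zero_iff.2 fun t _ => by simp [Complex.exp_ne_zero], fun j => ?_⟩
  have hchar : ZMod.stdAddChar (-((k : ZMod n) * j)) =
      ∏ _t ∈ range (2 * k), Complex.exp (-(Real.pi * Complex.I * j.val / n)) := by
    rw [prod_const, card_range, AddChar.map_neg_eq_inv, ← nsmul_eq_mul,
      AddChar.map_nsmul_eq_pow, stdAddChar_eq_exp, ← Complex.exp_nat_mul, ← Complex.exp_neg,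
      ← Complex.exp_nat_mul]
    congr 1
    push_cast
    ring
  rw [hchar, sineProd, eval_prod, ← prod_mul_distrib, ← prod_mul_distrib, Complex.ofReal_prod]
  refine prod_congr rfl fun t _ => ?_
  set a : ℂ := Real.pi * Complex.I * j.val / n with ha
  set b : ℂ := Real.pi * Complex.I * (t + 1) / n with hb
  have e1 : ZMod.stdAddChar j = Complex.exp a * Complex.exp a := by
    rw [stdAddChar_eq_exp, ← Complex.exp_add]; congr 1; rw [ha]; ring
  have e2 : ZMod.stdAddChar (1 : ZMod n) ^ (t + 1) = Complex.exp b * Complex.exp b := by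
    rw [h1, ← Complex.exp_nat_mul, ← Complex.exp_add]; congr 1; rw [hb]; push_cast; ring
  have e3 : ((Real.pi * (j.val + t + 1) / n : ℝ) : ℂ) * Complex.I = a + b := by
    rw [ha, hb]; push_cast; ring
  simp only [eval_sub, eval_mul, eval_C, eval_X, eval_one, e1, e2]
  rw [Complex.ofReal_mul, Complex.ofReal_sin, Complex.ofReal_ofNat, Complex.sin, neg_mul, e3,
    neg_add, Complex.exp_add, Complex.exp_add, Complex.exp_neg a, Complex.exp_neg b]
  have := Complex.exp_ne_zero a
  have := Complex.exp_ne_zero b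
  field_simp
  ring

/-- The circulant matrix whose eigenvalues are the `sineProd n k j`. -/
noncomputable def sineMatrix (n k : ℕ) [NeZero n] : Matrix (ZMod n) (ZMod n) ℂ :=
  let F : Matrix (ZMod n) (ZMod n) ℂ := .of fun x j => ZMod.stdAddChar (j * x)
  F * Matrix.diagonal (fun j => (sineProd n k j : ℂ)) * F.conjTranspose

theorem sineMatrix_posSemidef (n k : ℕ) [NeZero n] : (sineMatrix n k).PosSemidef := by
  refine Matrix.PosSemidef.mul_mul_conjTranspose_same (Matrix.PosSemidef.diagonal fun j => ?_) _
  exact Complex.zero_le_real.2 (sineProd_nonneg j)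

theorem rank_sineMatrix_le (n k : ℕ) [NeZero n] : (sineMatrix n k).rank ≤ n - 2 * k := by
  refine (Matrix.rank_mul_le_left _ _).trans ((Matrix.rank_mul_le_right _ _).trans ?_)
  rw [Matrix.rank_diagonal, Fintype.card_subtype]
  conv_rhs => rw [← card_range (n - 2 * k)]
  refine card_le_card_of_injOn ZMod.val ?_ ((ZMod.val_injective n).injOn)
  intro j hj
  rw [mem_coe, mem_range]
  by_contra h
  simp [sineProd_eq_zero (not_lt.1 h)] at hj

theorem sineMatrix_apply (n k : ℕ) [NeZero n] (x y : ZMod n) :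
    sineMatrix n k x y = ∑ j, (sineProd n k j : ℂ) * ZMod.stdAddChar (j * (x - y)) := by
  rw [sineMatrix, Matrix.mul_apply]
  simp only [Matrix.mul_diagonal, Matrix.conjTranspose_apply, Matrix.of_apply]
  refine sum_congr rfl fun j _ => ?_
  rw [mul_sub, sub_eq_add_neg, AddChar.map_add_eq_mul, AddChar.map_neg_eq_conj]
  simp only [RCLike.star_def]
  ring

theorem sineMatrix_isCirculantMatrix (n k : ℕ) [NeZero n] :
    IsCirculantMatrix (sineMatrix n k) :=
  ⟨fun d => ∑ j, (sineProd n k j : ℂ) * ZMod.stdAddChar (j * d), by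
    ext x y; rw [sineMatrix_apply, Matrix.circulant_apply]⟩

/-- Orthogonality of characters extracts the coefficients of `P` at the `m` with `m + d = k`; since
`2k < n` there is at most one, so nothing cancels. -/
theorem sum_sineProd_ne_zero_iff {n k : ℕ} [NeZero n] (hkn : 2 * k < n) (d : ZMod n) :
    ∑ j, (sineProd n k j : ℂ) * ZMod.stdAddChar (j * d) ≠ 0 ↔
      ∃ m ≤ 2 * k, (m : ZMod n) + d = k := by
  obtain ⟨c, hc, h⟩ := sineProd_eq_eval n k
  set P : ℂ[X] := ∏ t ∈ range (2 * k),
    (C (ZMod.stdAddChar (1 : ZMod n) ^ (t + 1)) * X - 1 : ℂ[X]) with hP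
  have key : ∑ j, (sineProd n k j : ℂ) * ZMod.stdAddChar (j * d) =
      c * n * ∑ m ∈ range (2 * k + 1), if (m : ZMod n) + d = k then P.coeff m else 0 := by
    have hdeg : P.natDegree < 2 * k + 1 := Nat.lt_succ_of_le (natDegree_qProd_le _ _)
    have hterm : ∀ j : ZMod n, (sineProd n k j : ℂ) * ZMod.stdAddChar (j * d) =
        ∑ m ∈ range (2 * k + 1),
          c * (P.coeff m * ZMod.stdAddChar (j * ((m : ZMod n) + d - (k : ZMod n)))) := by
      intro j
      rw [h j, eval_eq_sum_range' hdeg, mul_sum, sum_mul]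
      refine sum_congr rfl fun m _ => ?_
      have : j * ((m : ZMod n) + d - (k : ZMod n)) = -(k * j) + m • j + j * d := by
        rw [nsmul_eq_mul]; ring
      rw [this, AddChar.map_add_eq_mul, AddChar.map_add_eq_mul, AddChar.map_nsmul_eq_pow]
      ring
    rw [sum_congr rfl fun j _ => hterm j, sum_comm, mul_sum]
    refine sum_congr rfl fun m _ => ?_
    rw [← mul_sum, ← mul_sum, AddChar.sum_mulShift _ (ZMod.isPrimitive_stdAddChar n), ZMod.card]
    simp only [sub_eq_zero]
    split_ifs <;> push_cast <;> ring
  have hn : (n : ℂ) ≠ 0 := Nat.cast_ne_zero.2 (NeZero.ne n)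
  rw [key]
  constructor
  · intro h0
    by_contra! hno
    refine h0 ?_
    rw [sum_eq_zero, mul_zero]
    intro m hm
    rw [if_neg (hno m (by have := mem_range.1 hm; omega))]
  · rintro ⟨m, hm, hmd⟩
    rw [sum_eq_single m, if_pos hmd]
    · exact mul_ne_zero (mul_ne_zero hc hn)
        (coeff_qProd_ne_zero (isPrimitiveRoot_stdAddChar_one n) hkn hm)
    · intro m' hm' hne
      refine if_neg fun h' => hne ?_
      have h2 := add_right_cancel (h'.trans hmd.symm)
      have := mem_range.1 hm'
      rw [ZMod.natCast_eq_natCast_iff', Nat.mod_eq_of_lt (by omega),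
        Nat.mod_eq_of_lt (by omega)] at h2
      exact h2
    · intro h'
      exact absurd (mem_range.2 (by omega)) h'

theorem exists_add_eq_iff_mem_consecutiveSet {n k : ℕ} {d : ZMod n} (hd : d ≠ 0) :
    (∃ m ≤ 2 * k, (m : ZMod n) + d = k) ↔ d ∈ consecutiveSet n k := by
  simp only [consecutiveSet, mem_union, mem_image, mem_Icc]
  constructor
  · rintro ⟨m, hm, h⟩
    have hne : m ≠ k := by
      rintro rfl
      exact hd (by simpa using h)
    rcases lt_or_gt_of_ne hne with hlt | hlt
    · refine Or.inl ⟨k - m, ⟨by omega, by omega⟩, ?_⟩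
      rw [Nat.cast_sub hlt.le, ← h]; ring
    · refine Or.inr ⟨m - k, ⟨by omega, by omega⟩, ?_⟩
      rw [Nat.cast_sub hlt.le, ← h]; ring
  · rintro (⟨j, ⟨h1, h2⟩, rfl⟩ | ⟨j, ⟨h1, h2⟩, rfl⟩)
    · exact ⟨k - j, by omega, by rw [Nat.cast_sub h2]; ring⟩
    · exact ⟨k + j, by omega, by push_cast; ring⟩

theorem sineMatrix_isGraphOf {n k : ℕ} [NeZero n] (hkn : 2 * k < n) :
    IsGraphOf (circ n (consecutiveSet n k)) (sineMatrix n k) := by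
  intro x y hxy
  rw [circ_consecutiveSet_adj (by omega), sineMatrix_apply, sum_sineProd_ne_zero_iff hkn,
    exists_add_eq_iff_mem_consecutiveSet (sub_ne_zero.2 hxy)]

/-! ### Both bounds, including the complete graph `n = 2k` -/

theorem exists_circulant_rank_le {n k : ℕ} [NeZero n] (hk : 1 ≤ k) (hkn : k ≤ n / 2) :
    ∃ A ∈ posSemidefClass (circ n (consecutiveSet n k)),
      IsCirculantMatrix A ∧ A.rank ≤ n - (consecutiveSet n k).card := by
  rcases lt_or_ge (2 * k) n with h | h
  · refine ⟨sineMatrix n k, ⟨sineMatrix_posSemidef n k, sineMatrix_isGraphOf h⟩,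
      sineMatrix_isCirculantMatrix n k, ?_⟩
    rw [card_consecutiveSet h]
    exact rank_sineMatrix_le n k
  · have hn : n = 2 * k := by omega
    refine ⟨Matrix.vecMulVec 1 (star 1), ⟨Matrix.posSemidef_vecMulVec_self_star 1, ?_⟩,
      ⟨fun _ => 1, ?_⟩, ?_⟩
    · intro x y hxy
      rw [circ_consecutiveSet_adj (by omega)]
      have h0 : 0 < (x - y).val :=
        Nat.pos_of_ne_zero fun h => hxy (sub_eq_zero.1 ((ZMod.val_eq_zero _).1 h))
      have hm := (natCast_mem_consecutiveSet (n := n) (k := k) (by omega) h0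
        (ZMod.val_lt _)).2 (by omega)
      rw [ZMod.natCast_zmod_val] at hm
      simp [hm, Matrix.vecMulVec_apply]
    · ext x y
      simp [Matrix.vecMulVec_apply]
    · rw [card_consecutiveSet_half hk hn]
      exact (Matrix.rank_vecMulVec_le _ _).trans (by omega)

theorem sub_card_le_rank {n k : ℕ} [NeZero n] (hk : 1 ≤ k) (hkn : k ≤ n / 2)
    {A : Matrix (ZMod n) (ZMod n) ℂ} (hA : IsGraphOf (circ n (consecutiveSet n k)) A) :
    n - (consecutiveSet n k).card ≤ A.rank := by
  rcases lt_or_ge (2 * k) n with h | h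
  · rw [card_consecutiveSet h]
    exact sub_two_mul_le_rank hk h hA
  · have hn : n = 2 * k := by omega
    rw [card_consecutiveSet_half hk hn]
    have hm := (natCast_mem_consecutiveSet (n := n) (k := k) (d := 1) (by omega) one_pos
      (by omega)).2 (Or.inl hk)
    rw [Nat.cast_one] at hm
    have hadj : (circ n (consecutiveSet n k)).Adj 1 0 := by
      rw [circ_consecutiveSet_adj (by omega), sub_zero]
      exact hm
    have h10 : A 1 0 ≠ 0 := (hA 1 0 hadj.ne).1 hadj
    have hr := Matrix.rank_of_isUnit (A.submatrix (fun _ : Unit => 1) (fun _ => 0))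
      ((Matrix.isUnit_iff_isUnit_det _).2 (by simpa using h10))
    have h1 : 1 ≤ A.rank := by
      rw [← Fintype.card_unit, ← hr]
      exact Matrix.rank_submatrix_le _ _ _
    omega

end CirculantRank

theorem mainTheorem1 (n k : ℕ) [NeZero n] (hk : 1 ≤ k) (hkn : k ≤ n / 2)
    (S : Finset (ZMod n)) (hS : S = CirculantRank.consecutiveSet n k)
    (G : SimpleGraph (ZMod n)) (hG : G = CirculantRank.circ n S) :
    CirculantRank.mscr G = CirculantRank.msr G ∧
      CirculantRank.msr G = CirculantRank.mr G ∧
      CirculantRank.mr G = n - S.card := by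
  subst hS hG
  obtain ⟨A, hA, hcirc, hrank⟩ := CirculantRank.exists_circulant_rank_le hk hkn
  have heq := le_antisymm hrank (CirculantRank.sub_card_le_rank hk hkn hA.2)
  have h1 : CirculantRank.mscr (CirculantRank.circ n (CirculantRank.consecutiveSet n k)) =
      n - (CirculantRank.consecutiveSet n k).card := by
    refine IsLeast.csInf_eq ⟨⟨A, hA, hcirc, heq⟩, ?_⟩
    rintro r ⟨B, hB, -, rfl⟩
    exact CirculantRank.sub_card_le_rank hk hkn hB.2
  have h2 : CirculantRank.msr (CirculantRank.circ n (CirculantRank.consecutiveSet n k)) =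
      n - (CirculantRank.consecutiveSet n k).card := by
    refine IsLeast.csInf_eq ⟨⟨A, hA, heq⟩, ?_⟩
    rintro r ⟨B, hB, rfl⟩
    exact CirculantRank.sub_card_le_rank hk hkn hB.2
  have h3 : CirculantRank.mr (CirculantRank.circ n (CirculantRank.consecutiveSet n k)) =
      n - (CirculantRank.consecutiveSet n k).card := by
    refine IsLeast.csInf_eq ⟨⟨A, ⟨hA.1.isHermitian, hA.2⟩, heq⟩, ?_⟩
    rintro r ⟨B, hB, rfl⟩
    exact CirculantRank.sub_card_le_rank hk hkn hB.2
  exact ⟨h1.trans h2.symm, h2.trans h3.symm, h3⟩
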